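/- Let $k,q\ge 1$ be integers and let $W_{k,q}=\{\mathbf v\in\mathbb Z^{k-1}: 0\le v_1\le v_2\le\cdots\le v_{k-1}\le q\}$. A permutation $\pi=\pi_1\pi_2\ldots\pi_{k-1}$ of $\{1,\ldots,k-1\}$ is \emph{consistent} with $\mathbf v\in W_{k,q}$ if $i$ stands before $i+1$ in $\pi$ whenever $v_i=v_{i+1}$. The \emph{edgewise subdivision} $T_{k,q}$ of the simplex $\{\mathbf x\in\mathbb R^{k-1}:0\le x_1\le\cdots\le x_{k-1}\le q\}$ is the simplicial complex whose facets are the simplices with vertex sets $$F(\mathbf v,\pi)=\{\mathbf v^{(1)},\ldots,\mathbf v^{(k)}\},\qquad \mathbf v^{(j+1)}=\mathbf v+e_{\pi_{k-1}}+e_{\pi_{k-2}}+\cdots+e_{\pi_{k-j}}\quad(0\le j\le k-1),$$ where $\mathbf v\in W_{k,q}$, $\pi$ is consistent with $\mathbf v$, and $F(\mathbf v,\pi)\subseteq W_{k,q}$. For a $d$-dimensional simplicial complex $K$ with $f_i$ faces of dimension $i$ ($f_{-1}=1$), the $h$-vector $(h_0,\ldots,h_{d+1})$ is defined by $$h_s(K)=\sum_{i=0}^{s}(-1)^{s-i}\binom{d+1-i}{d+1-s}f_{i-1}.$$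 \textbf{Theorem.} The entries of the $h$-vector of $T_{k,q}$ (which has dimension $k-1$) are, for $0\le i\le k$, $$h_i(T_{k,q})=\sum_{j=0}^{i}(-1)^j\binom{k}{j}\binom{(i-j)q+k-1}{k-1}.$$ -/

import Mathlib

/-! ### The `f`-vector and the `h`-vector of a finite simplicial complex -/

namespace PreAbstractSimplicialComplex

variable {ι : Type*}

/-- `dim K + 1`, that is, the largest number of vertices of a face of a finite complex `K`
(`0` if the empty face is the only face). -/
noncomputable def dimAddOne (K : PreAbstractSimplicialComplex ι) : ℕ :=
  sSup (Finset.card '' K.faces)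

/-- `K.fVector m` is `f_{m-1}(K)`, the number of faces of `K` with `m` vertices. The empty face,
which Mathlib does not list among the faces, gives `f_{-1}(K) = 1`. -/
noncomputable def fVector (K : PreAbstractSimplicialComplex ι) (m : ℕ) : ℕ :=
  if m = 0 then 1 else Set.ncard {s | s ∈ K.faces ∧ s.card = m}

/-- The entry `h_s(K) = ∑_{i=0}^{s} (-1)^{s-i} C(d+1-i, d+1-s) f_{i-1}(K)` of the `h`-vector of a
`d`-dimensional complex `K`; it is meant for `0 ≤ s ≤ d+1`. -/
noncomputable def hVector (K : PreAbstractSimplicialComplex ι) (s : ℕ) : ℤ :=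
  ∑ i ∈ Finset.range (s + 1),
    (-1) ^ (s - i) * ((K.dimAddOne - i).choose (K.dimAddOne - s) : ℤ) * (K.fVector i : ℤ)

end PreAbstractSimplicialComplex

/-! ### The edgewise subdivision. Coordinates and positions are counted from `0`. -/

namespace EdgewiseSubdivision

/-- The lattice points `0 ≤ v₁ ≤ v₂ ≤ ⋯ ≤ v_{k-1} ≤ q` of the simplex `R_{k,q}`. -/
def vertexSet (k q : ℕ) : Set (Fin (k - 1) → ℤ) :=
  {v | Monotone v ∧ ∀ i, 0 ≤ v i ∧ v i ≤ q}

/-- The permutation `π = π₁ π₂ … π_{k-1}` (a word, `π p` being the letter at position `p`) is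
consistent with `v` if `i` stands before `i + 1` in `π` whenever `v_i = v_{i+1}`. -/
def Consistent {k : ℕ} (v : Fin (k - 1) → ℤ) (π : Equiv.Perm (Fin (k - 1))) : Prop :=
  ∀ i j : Fin (k - 1), (j : ℕ) = i + 1 → v i = v j → π.symm i < π.symm j

/-- `facetVertex v π j` is `v^{(j+1)}`: the vector `v` with the coordinates named by the last `j`
letters of `π` increased by one. -/
def facetVertex {k : ℕ} (v : Fin (k - 1) → ℤ) (π : Equiv.Perm (Fin (k - 1))) (j : Fin k) :
    Fin (k - 1) → ℤ :=
  v + ∑ p ∈ Finset.univ.filter (fun p : Fin (k - 1) => k - 1 ≤ p.val + j.val), Pi.single (π p) 1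

/-- The vertex set `{v^{(1)}, …, v^{(k)}}` of the cell `F(v, π)`. -/
def facet {k : ℕ} (v : Fin (k - 1) → ℤ) (π : Equiv.Perm (Fin (k - 1))) :
    Finset (Fin (k - 1) → ℤ) :=
  Finset.univ.image (facetVertex v π)

/-- The facets of the edgewise subdivision: the cells `F(v, π)` with `v` a vertex and `π` consistent
with `v`, all of whose vertices are vertices of the subdivision. -/
def facets (k q : ℕ) : Set (Finset (Fin (k - 1) → ℤ)) :=
  {F | ∃ v ∈ vertexSet k q, ∃ π : Equiv.Perm (Fin (k - 1)),
    Consistent v π ∧ (facet v π : Set (Fin (k - 1) → ℤ)) ⊆ vertexSet k q ∧ F = facet v π}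

end EdgewiseSubdivision

/-- The edgewise subdivision `T_{k,q}` of the simplex `R_{k,q}`, each cell being given by its set of
vertices: its nonempty faces are the nonempty subsets of its facets. -/
def edgewiseSubdivision (k q : ℕ) : PreAbstractSimplicialComplex (Fin (k - 1) → ℤ) where
  faces := {s | s.Nonempty ∧ ∃ F ∈ EdgewiseSubdivision.facets k q, s ⊆ F}
  isRelLowerSet_faces := by
    rintro s ⟨hs, F, hF, hsF⟩
    exact ⟨hs, fun t hts ht => ⟨ht, F, hF, hts.trans hsF⟩⟩

/-! ### Counting multisets and monotone tuples -/

/-! Count in two ways the multisets of `n` vertices whose support is a face (possibly empty).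
Sorting by support, a face with `m` vertices contributes `x^m / (1 - x)^m` to the generating
function, so the total is `h(x) / (1 - x)^k`. On the other hand, faces are exactly the chains of
vertices within a unit cube (`mem_faces_iff`), and taking sums is a bijection from these multisets
onto the lattice points of the simplex of size `nq` (`card_multisets_cells`): in increasing order,
the `j`-th member must have coordinates `⌊(x_c + j) / n⌋`, and by Hermite's identity these vectors
do sum to `x`. There are `C(nq + k - 1, k - 1)` such points. Multiplying by `(1 - x)^k` and
comparing coefficients gives the formula. -/

theorem Finset.card_sym {α : Type*} [DecidableEq α] (s : Finset α) (n : ℕ) :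
    (s.sym n).card = s.card.multichoose n := by
  have h : s = Finset.map (Function.Embedding.subtype (· ∈ s)) Finset.univ := by
    ext a; simp
  conv_lhs => rw [h]
  rw [Finset.sym_map, Finset.card_map, Finset.sym_univ, Finset.card_univ,
    Sym.card_sym_eq_multichoose, Fintype.card_coe]

/-- The number of monotone `m`-tuples in a finite set. -/
theorem ncard_monotone_tuples {α : Type*} [LinearOrder α] (T : Finset α) (m : ℕ) :
    {v : Fin m → α | Monotone v ∧ ∀ i, v i ∈ T}.ncard = T.card.multichoose m := by
  rw [← Finset.card_sym, ← Set.ncard_coe_finset]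
  refine Set.ncard_congr (fun v _ => (⟨(List.ofFn v : Multiset α), by simp⟩ : Sym α m)) ?_ ?_ ?_
  · rintro v ⟨-, hv⟩
    refine Finset.mem_coe.2 (Finset.mem_sym_iff.2 fun a ha => ?_)
    have ha' : a ∈ List.ofFn v := by simpa using ha
    obtain ⟨i, rfl⟩ := (List.mem_ofFn' _ _).1 ha'
    exact hv i
  · rintro v w ⟨hv, -⟩ ⟨hw, -⟩ h
    have h' : (List.ofFn v).Perm (List.ofFn w) := Multiset.coe_eq_coe.1 (congrArg Subtype.val h)
    exact List.ofFn_injective (h'.eq_of_sortedLE hv.sortedLE_ofFn hw.sortedLE_ofFn)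
  · rintro ⟨M, hM⟩ hT
    have hl : (M.sort (· ≤ ·)).length = m := by simp [hM]
    have hs : (M.sort (· ≤ ·)).SortedLE := (Multiset.pairwise_sort M (· ≤ ·)).sortedLE
    refine ⟨fun i => (M.sort (· ≤ ·)).get (i.cast hl.symm), ⟨?_, ?_⟩, ?_⟩
    · intro i j hij
      exact hs.monotone_get (by simpa using hij)
    · intro i
      refine (Finset.mem_sym_iff.1 (Finset.mem_coe.1 hT)) _ ?_
      have := List.get_mem (M.sort (· ≤ ·)) (i.cast hl.symm)
      exact (Multiset.mem_sort _).1 this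
    · apply Subtype.ext
      have : List.ofFn (fun i : Fin m => (M.sort (· ≤ ·)).get (i.cast hl.symm))
          = M.sort (· ≤ ·) := by
        subst hl
        exact List.ofFn_get _
      simp only [this, Multiset.sort_eq]

/-- The multisets of cardinality `n` whose set of elements is exactly `s`. -/
def multisetsWithSupport {α : Type*} [DecidableEq α] (n : ℕ) (s : Finset α) :
    Finset (Multiset α) :=
  if s.card ≤ n then (s.sym (n - s.card)).image (fun M => M.1 + s.val) else ∅

/-- One copy of each element of `s` is forced; what remains is an arbitrary multiset in `s`. -/
theorem mem_multisetsWithSupport {α : Type*} [DecidableEq α] {n : ℕ} {s : Finset α}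
    {M : Multiset α} : M ∈ multisetsWithSupport n s ↔ M.card = n ∧ M.toFinset = s := by
  unfold multisetsWithSupport
  split_ifs with h
  · simp only [Finset.mem_image, Finset.mem_sym_iff]
    constructor
    · rintro ⟨N, hN, rfl⟩
      refine ⟨by simp [h], ?_⟩
      ext a
      simp only [Multiset.toFinset_add, Finset.mem_union, Multiset.mem_toFinset, Finset.val_toFinset]
      exact ⟨fun h => h.elim (hN a) id, Or.inr⟩
    · rintro ⟨hM, rfl⟩
      have hle : M.toFinset.val ≤ M := by
        rw [Multiset.toFinset_val]; exact Multiset.dedup_le M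
      refine ⟨⟨M - M.toFinset.val, ?_⟩, ?_, ?_⟩
      · rw [Multiset.card_sub hle, hM]; rfl
      · intro a ha
        have ha' : a ∈ M - M.toFinset.val := ha
        exact Multiset.mem_toFinset.2 (Multiset.mem_of_le (Multiset.sub_le_self _ _) ha')
      · exact tsub_add_cancel_of_le hle
  · simp only [Finset.notMem_empty, false_iff]
    rintro ⟨rfl, rfl⟩
    exact h (Multiset.toFinset_card_le M)

theorem card_multisetsWithSupport {α : Type*} [DecidableEq α] (n : ℕ) (s : Finset α) :
    (multisetsWithSupport n s).card =
      if s.card ≤ n then s.card.multichoose (n - s.card) else 0 := by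
  unfold multisetsWithSupport
  split_ifs with h
  · rw [Finset.card_image_of_injective, Finset.card_sym]
    intro M N h
    exact Subtype.ext (add_right_cancel h)
  · rfl

/-! ### From counting multisets to the `h`-vector -/

open PowerSeries in
-- Multiplying by `1 - X` takes differences of coefficients, which lowers `m` by Pascal's rule.
theorem one_sub_X_pow_mul_mk_multichoose (m : ℕ) :
    (1 - X : ℤ⟦X⟧) ^ m * mk (fun n => (m.multichoose n : ℤ)) = 1 := by
  induction m with
  | zero =>
    ext n
    cases n <;> simp [coeff_one]
  | succ m ih =>
    have h : (1 - X : ℤ⟦X⟧) * mk (fun n => ((m + 1).multichoose n : ℤ)) =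
        mk (fun n => (m.multichoose n : ℤ)) := by
      ext n
      cases n with
      | zero => simp [sub_mul]
      | succ n =>
        rw [sub_mul, one_mul, map_sub, coeff_succ_X_mul]
        simp only [coeff_mk, Nat.multichoose_succ_succ]
        push_cast; ring
    rw [pow_succ, mul_assoc, h, ih]

open PowerSeries in
theorem coeff_one_sub_X_pow (d n : ℕ) :
    coeff n ((1 - X : ℤ⟦X⟧) ^ d) = (-1) ^ n * (d.choose n : ℤ) := by
  have h : (1 - X : ℤ⟦X⟧) ^ d = (((1 - Polynomial.X : Polynomial ℤ) ^ d : Polynomial ℤ) : ℤ⟦X⟧) := by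
    push_cast; rfl
  rw [h, Polynomial.coeff_coe, sub_eq_add_neg, add_comm, add_pow, Polynomial.finsetSum_coeff]
  simp only [one_pow, mul_one]
  have : ∀ i, ((-Polynomial.X : Polynomial ℤ) ^ i * (d.choose i : Polynomial ℤ)).coeff n =
      if n = i then (-1) ^ n * (d.choose n : ℤ) else 0 := by
    intro i
    rw [neg_pow, Polynomial.coeff_mul_natCast, show (-1 : Polynomial ℤ) = Polynomial.C (-1) by simp,
      ← Polynomial.C_pow, Polynomial.coeff_C_mul_X_pow]
    split_ifs with h
    · subst h; rfl
    · simp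
  simp only [this, Finset.sum_ite_eq, Finset.mem_range]
  split_ifs with h
  · rfl
  · rw [Nat.choose_eq_zero_of_lt (by omega)]; simp

open PowerSeries in
-- This is the coefficient of `X^s` in `(1 - X)^d * X^m / (1 - X)^m = X^m * (1 - X)^(d - m)`.
theorem sum_neg_one_pow_choose_mul_multichoose {d m : ℕ} (hm : m ≤ d) (s : ℕ) :
    ∑ j ∈ Finset.range (s + 1), (-1 : ℤ) ^ j * (d.choose j : ℤ) *
        ((if m ≤ s - j then m.multichoose (s - j - m) else 0 : ℕ) : ℤ) =
      if m ≤ s then (-1) ^ (s - m) * ((d - m).choose (s - m) : ℤ) else 0 := by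
  have key : (1 - X : ℤ⟦X⟧) ^ d * (X ^ m * mk (fun n => (m.multichoose n : ℤ))) =
      X ^ m * (1 - X) ^ (d - m) := by
    have : (1 - X : ℤ⟦X⟧) ^ d = (1 - X) ^ (d - m) * (1 - X) ^ m := by
      rw [← pow_add, Nat.sub_add_cancel hm]
    rw [this]
    linear_combination (1 - X : ℤ⟦X⟧) ^ (d - m) * X ^ m * one_sub_X_pow_mul_mk_multichoose m
  have h := congrArg (coeff s) key
  rw [coeff_mul, Finset.Nat.sum_antidiagonal_eq_sum_range_succ_mk] at h
  simp only [coeff_one_sub_X_pow, coeff_X_pow_mul', coeff_mk] at h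
  rw [← h]
  refine Finset.sum_congr rfl fun j _ => ?_
  split_ifs <;> simp

/-- If `𝓕` is a finite family of finsets of size at most `d`, the alternating binomial transform of
the numbers of multisets supported on a member of `𝓕` is the `h`-vector of `𝓕`. -/
theorem sum_neg_one_pow_choose_mul_card_multisets {α : Type*} [DecidableEq α]
    (𝓕 : Finset (Finset α)) {d s : ℕ} (hd : ∀ F ∈ 𝓕, F.card ≤ d) (hs : s ≤ d) :
    ∑ j ∈ Finset.range (s + 1), (-1 : ℤ) ^ j * (d.choose j : ℤ) *
        ((𝓕.biUnion (multisetsWithSupport (s - j))).card : ℤ) =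
      ∑ i ∈ Finset.range (s + 1), (-1) ^ (s - i) * ((d - i).choose (d - s) : ℤ) *
        ((𝓕.filter (fun F => F.card = i)).card : ℤ) := by
  have hcard : ∀ n, (𝓕.biUnion (multisetsWithSupport n)).card =
      ∑ F ∈ 𝓕, if F.card ≤ n then F.card.multichoose (n - F.card) else 0 := by
    intro n
    rw [Finset.card_biUnion]
    · exact Finset.sum_congr rfl fun F _ => card_multisetsWithSupport n F
    · intro F _ G _ hFG
      refine Finset.disjoint_left.2 fun M hM hM' => ?_
      exact hFG ((mem_multisetsWithSupport.1 hM).2.symm.trans (mem_multisetsWithSupport.1 hM').2)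
  simp only [hcard, Nat.cast_sum, Finset.mul_sum, Finset.card_filter]
  rw [Finset.sum_comm]
  conv_rhs => rw [Finset.sum_comm]
  refine Finset.sum_congr rfl fun F hF => ?_
  rw [sum_neg_one_pow_choose_mul_multichoose (hd F hF)]
  simp only [Nat.cast_ite, Nat.cast_one, Nat.cast_zero, mul_ite, mul_one, mul_zero,
    Finset.sum_ite_eq, Finset.mem_range, Nat.lt_succ_iff]
  split_ifs with h
  · rw [← Nat.choose_symm (show s - F.card ≤ d - F.card by omega)]
    congr 3; omega
  · rfl

/-! ### Balanced tuples of integers -/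

/-- A monotone tuple of integers with steps adding up to at most one is determined by its sum. -/
theorem eq_sum_add_ediv_of_monotone {n : ℕ} {a : Fin n → ℤ} (ha : Monotone a)
    (h : ∀ i j, a j ≤ a i + 1) (j : Fin n) : a j = (∑ i, a i + j) / n := by
  -- The `j` earlier entries are at least `a j - 1`, the others at least `a j`; `hupp` is the mirror
  -- bound. Together they pin down the quotient.
  have hlow : (n : ℤ) * a j - j ≤ ∑ i, a i := by
    have : ∑ i, (a j - if i < j then 1 else 0) ≤ ∑ i, a i := by
      refine Finset.sum_le_sum fun i _ => ?_
      split_ifs with hij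
      · linarith [h i j]
      · linarith [ha (not_lt.1 hij)]
    rw [Finset.sum_sub_distrib, Finset.sum_boole] at this
    simpa [Finset.filter_gt_eq_Iio] using this
  have hupp : ∑ i, a i ≤ (n : ℤ) * a j + (n - 1 - j) := by
    have : ∑ i, a i ≤ ∑ i, (a j + if j < i then 1 else 0) := by
      refine Finset.sum_le_sum fun i _ => ?_
      split_ifs with hij
      · linarith [h j i]
      · linarith [ha (not_lt.1 hij)]
    rw [Finset.sum_add_distrib, Finset.sum_boole] at this
    have hc : ((Finset.univ.filter fun i => j < i).card : ℤ) = n - 1 - j := by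
      rw [Finset.filter_lt_eq_Ioi, Fin.card_Ioi]
      omega
    rw [hc] at this
    simpa using this
  have hn : (0 : ℤ) < n := by exact_mod_cast j.pos
  apply le_antisymm
  · rw [Int.le_ediv_iff_mul_le hn]; linarith
  · rw [← Int.lt_add_one_iff, Int.ediv_lt_iff_lt_mul hn]; linarith

/-- Hermite's identity for integers. -/
theorem sum_range_add_ediv {n : ℕ} (hn : 0 < n) (x : ℤ) :
    ∑ j ∈ Finset.range n, (x + j) / (n : ℤ) = x := by
  have hn' : (n : ℤ) ≠ 0 := by exact_mod_cast hn.ne'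
  have step : ∀ y : ℤ, ∑ j ∈ Finset.range n, (y + 1 + j) / (n : ℤ) =
      ∑ j ∈ Finset.range n, (y + j) / (n : ℤ) + 1 := by
    intro y
    have h1 := Finset.sum_range_succ (fun j : ℕ => (y + j) / (n : ℤ)) n
    -- Passing from `y` to `y + 1` only replaces the term `y / n` by `(y + n) / n`.
    have h2 := Finset.sum_range_succ' (fun j : ℕ => (y + j) / (n : ℤ)) n
    have h3 : (y + n) / (n : ℤ) = y / n + 1 := by
      rw [Int.add_ediv_of_dvd_right (dvd_refl _), Int.ediv_self hn']
    have h4 : ∑ j ∈ Finset.range n, (y + 1 + j) / (n : ℤ) =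
        ∑ j ∈ Finset.range n, (y + ((j + 1 : ℕ) : ℤ)) / (n : ℤ) := by
      refine Finset.sum_congr rfl fun j _ => ?_
      push_cast
      congr 1; ring
    rw [h4]
    simp only [Nat.cast_zero, add_zero] at h2
    linarith
  induction x using Int.induction_on with
  | zero =>
    refine Finset.sum_eq_zero fun j hj => ?_
    rw [zero_add]
    exact Int.ediv_eq_zero_of_lt (by positivity) (by exact_mod_cast Finset.mem_range.1 hj)
  | succ i ih => rw [step, ih]
  | pred i ih =>
    have := step (-(i : ℤ) - 1)
    rw [sub_add_cancel, ih] at this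
    linarith

/-- A multiset whose elements are pairwise comparable can be listed in increasing order. -/
theorem Multiset.exists_pairwise_le_list {α : Type*} [PartialOrder α] (M : Multiset α)
    (h : ∀ a ∈ M, ∀ b ∈ M, a ≤ b ∨ b ≤ a) :
    ∃ l : List α, l.Pairwise (· ≤ ·) ∧ (l : Multiset α) = M := by
  classical
  induction hn : M.card generalizing M with
  | zero => exact ⟨[], List.Pairwise.nil, (Multiset.card_eq_zero.1 hn).symm⟩
  | succ n ih =>
    have hne : M.toFinset.Nonempty := by
      rw [Multiset.toFinset_nonempty]
      rintro rfl
      simp at hn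
    obtain ⟨a, ha⟩ := M.toFinset.exists_minimal hne
    have haM : a ∈ M := Multiset.mem_toFinset.1 ha.1
    obtain ⟨l, hl, hlM⟩ := ih (M.erase a)
      (fun b hb c hc => h b (Multiset.mem_of_mem_erase hb) c (Multiset.mem_of_mem_erase hc))
      (by rw [Multiset.card_erase_of_mem haM, hn]; rfl)
    refine ⟨a :: l, List.pairwise_cons.2 ⟨fun b hb => ?_, hl⟩, ?_⟩
    · have hbM : b ∈ M := by
        refine Multiset.mem_of_mem_erase (a := b) (b := a) ?_
        rw [← hlM]; exact hb
      rcases h a haM b hbM with hab | hba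
      · exact hab
      · exact ha.2 (Multiset.mem_toFinset.2 hbM) hba
    · rw [← Multiset.cons_coe, hlM, Multiset.cons_erase haM]

/-! ### Cells and the lattice points of dilated simplices -/

namespace EdgewiseSubdivision

/-- Sets of pairwise comparable vertices lying in a common unit cube. -/
def IsCell {d : ℕ} (s : Set (Fin d → ℤ)) : Prop :=
  ∀ a ∈ s, ∀ b ∈ s, (a ≤ b ∨ b ≤ a) ∧ a ≤ b + 1

/-- The multiset on a cell is recovered from its cardinality and its sum. -/
theorem IsCell.eq_ofFn {d : ℕ} {M : Multiset (Fin d → ℤ)} (h : IsCell {a | a ∈ M}) :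
    M = (List.ofFn fun (j : Fin M.card) (c : Fin d) => (M.sum c + j) / (M.card : ℤ) :
      List (Fin d → ℤ)) := by
  obtain ⟨l, hl, rfl⟩ := M.exists_pairwise_le_list fun a ha b hb => (h a ha b hb).1
  congr 1
  simp only [Multiset.coe_card, Multiset.sum_coe]
  conv_lhs => rw [← List.ofFn_get l]
  congr 1
  funext j c
  have hm : Monotone fun j : Fin l.length => l.get j c :=
    fun i j hij => hl.sortedLE.monotone_get hij c
  have hsum : l.sum c = ∑ i : Fin l.length, l.get i c := by
    conv_lhs => rw [← List.ofFn_get l, List.sum_ofFn]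
    simp
  rw [hsum]
  exact eq_sum_add_ediv_of_monotone hm
    (fun i j => (h _ (List.get_mem l j) _ (List.get_mem l i)).2 c) j

theorem sum_mem_vertexSet {k q : ℕ} (M : Multiset (Fin (k - 1) → ℤ))
    (h : ∀ a ∈ M, a ∈ vertexSet k q) : M.sum ∈ vertexSet k (M.card * q) := by
  induction M using Multiset.induction_on with
  | empty => exact ⟨fun _ _ _ => le_rfl, fun _ => by simp⟩
  | cons a M ih =>
    obtain ⟨hm, hb⟩ := ih fun b hb => h b (Multiset.mem_cons_of_mem hb)
    obtain ⟨hm', hb'⟩ := h a (Multiset.mem_cons_self a M)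
    rw [Multiset.sum_cons, Multiset.card_cons]
    refine ⟨hm'.add hm, fun i => ?_⟩
    have h1 := hb i
    have h2 := hb' i
    push_cast at h1 ⊢
    simp only [Pi.add_apply]
    constructor <;> linarith

/-- The cells, including the empty one. -/
noncomputable def cells (k q : ℕ) : Finset (Finset (Fin (k - 1) → ℤ)) := by
  classical
  -- The box only provides finiteness; it contains every vertex.
  exact (Finset.Icc (0 : Fin (k - 1) → ℤ) (fun _ => (q : ℤ))).powerset.filter
    fun s => (s : Set (Fin (k - 1) → ℤ)) ⊆ vertexSet k q ∧ IsCell (s : Set (Fin (k - 1) → ℤ))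

theorem mem_cells {k q : ℕ} {s : Finset (Fin (k - 1) → ℤ)} : s ∈ cells k q ↔
    (s : Set (Fin (k - 1) → ℤ)) ⊆ vertexSet k q ∧ IsCell (s : Set (Fin (k - 1) → ℤ)) := by
  unfold cells
  simp only [Finset.mem_filter, Finset.mem_powerset, and_iff_right_iff_imp]
  rintro ⟨h, -⟩ a ha
  exact Finset.mem_Icc.2 ⟨fun i => ((h ha).2 i).1, fun i => ((h ha).2 i).2⟩

theorem ncard_vertexSet (k N : ℕ) (hk : 1 ≤ k) :
    (vertexSet k N).ncard = (N + k - 1).choose (k - 1) := by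
  have h := ncard_monotone_tuples (Finset.Icc (0 : ℤ) N) (k - 1)
  rw [Int.card_Icc, Nat.multichoose_eq] at h
  have e : ((N : ℤ) + 1 - 0).toNat + (k - 1) - 1 = N + k - 1 := by omega
  rw [e] at h
  rw [← h]
  congr 1
  ext v
  simp [vertexSet]

/-- Every lattice point of the `n`-fold dilated simplex is in a unique way the sum of `n` vertices
of a cell. -/
theorem card_multisets_cells (k q n : ℕ) :
    ((cells k q).biUnion (multisetsWithSupport n)).card = (vertexSet k (n * q)).ncard := by
  rw [← Set.ncard_coe_finset]
  have hmem : ∀ M : Multiset (Fin (k - 1) → ℤ), M ∈ (cells k q).biUnion (multisetsWithSupport n) ↔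
      M.card = n ∧ (∀ a ∈ M, a ∈ vertexSet k q) ∧ IsCell {a | a ∈ M} := by
    intro M
    have hco : ((M.toFinset : Finset (Fin (k - 1) → ℤ)) : Set (Fin (k - 1) → ℤ)) = {a | a ∈ M} := by
      ext a; simp
    simp only [Finset.mem_biUnion, mem_multisetsWithSupport]
    constructor
    · rintro ⟨s, hs, hM, rfl⟩
      rw [mem_cells, hco] at hs
      exact ⟨hM, hs.1, hs.2⟩
    · rintro ⟨hM, h1, h2⟩
      refine ⟨M.toFinset, ?_, hM, rfl⟩
      rw [mem_cells, hco]
      exact ⟨h1, h2⟩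
  refine Set.ncard_congr (fun M _ => M.sum) ?_ ?_ ?_
  · intro M hM
    obtain ⟨rfl, h1, -⟩ := (hmem M).1 hM
    exact sum_mem_vertexSet M h1
  · intro M N hM hN hMN
    obtain ⟨hM, -, hM'⟩ := (hmem M).1 hM
    obtain ⟨hN, -, hN'⟩ := (hmem N).1 hN
    have hMN' : M.sum = N.sum := hMN
    have hc : M.card = N.card := hM.trans hN.symm
    rw [hM'.eq_ofFn, hN'.eq_ofFn, hMN', hc]
  · rintro x ⟨hx, hb⟩
    -- The only possible preimage, by `IsCell.eq_ofFn`.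
    set u : ℕ → Fin (k - 1) → ℤ := fun j c => (x c + j) / (n : ℤ) with hu
    rcases Nat.eq_zero_or_pos n with rfl | hn
    · refine ⟨0, Finset.mem_coe.2 ((hmem 0).2 ⟨rfl, by simp, ?_⟩), ?_⟩
      · intro a ha
        exact absurd ha (Multiset.notMem_zero a)
      · funext c
        have := hb c
        simp only [zero_mul, Nat.cast_zero] at this
        simpa using le_antisymm this.1 this.2
    have hn' : (0 : ℤ) < n := by exact_mod_cast hn
    have humono : ∀ i j : ℕ, i ≤ j → u i ≤ u j := fun i j hij c =>
      Int.ediv_le_ediv hn' (by have : (i : ℤ) ≤ j := by exact_mod_cast hij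
                               linarith)
    refine ⟨(Multiset.range n).map u, Finset.mem_coe.2 ((hmem _).2 ⟨by simp, ?_, ?_⟩), ?_⟩
    · intro a ha
      obtain ⟨j, hj, rfl⟩ := Multiset.mem_map.1 ha
      have hj' : (j : ℤ) < n := by exact_mod_cast Multiset.mem_range.1 hj
      refine ⟨fun c c' hcc => Int.ediv_le_ediv hn' (by linarith [hx hcc]), fun c => ⟨?_, ?_⟩⟩
      · exact Int.ediv_nonneg (by have := (hb c).1; positivity) hn'.le
      · rw [← Int.lt_add_one_iff, Int.ediv_lt_iff_lt_mul hn']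
        have := (hb c).2
        push_cast at this
        linarith
    · intro a ha b hb
      rw [Set.mem_ofPred_eq] at ha hb
      obtain ⟨i, hi, rfl⟩ := Multiset.mem_map.1 ha
      obtain ⟨j, hj, rfl⟩ := Multiset.mem_map.1 hb
      have hi' : (i : ℤ) < n := by exact_mod_cast Multiset.mem_range.1 hi
      refine ⟨(le_total i j).imp (humono i j) (humono j i), fun c => ?_⟩
      have : (x c + j) / (n : ℤ) + 1 = (x c + j + n) / (n : ℤ) := by
        rw [Int.add_ediv_of_dvd_right (dvd_refl _), Int.ediv_self hn'.ne']
      simp only [hu, Pi.add_apply, Pi.one_apply]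
      rw [this]
      exact Int.ediv_le_ediv hn' (by have : (0 : ℤ) ≤ j := by positivity
                                     linarith)
    · funext c
      have : ((Multiset.range n).map u).sum = ∑ j ∈ Finset.range n, u j := rfl
      simp only [this, Finset.sum_apply]
      exact sum_range_add_ediv hn (x c)

end EdgewiseSubdivision

namespace EdgewiseSubdivision

/-! ### The cells are the faces -/

theorem facetVertex_apply {k : ℕ} (v : Fin (k - 1) → ℤ) (π : Equiv.Perm (Fin (k - 1))) (j : Fin k)
    (c : Fin (k - 1)) :
    facetVertex v π j c = v c + if k - 1 ≤ (π.symm c).val + j.val then 1 else 0 := by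
  simp only [facetVertex, Pi.add_apply, Finset.sum_apply, Pi.single_apply]
  congr 1
  have : ∀ p : Fin (k - 1), (c = π p) ↔ (π.symm c = p) := fun p => (Equiv.symm_apply_eq π).symm
  simp only [this, Finset.sum_ite_eq, Finset.mem_filter, Finset.mem_univ, true_and]

theorem facetVertex_mono {k : ℕ} (v : Fin (k - 1) → ℤ) (π : Equiv.Perm (Fin (k - 1))) :
    Monotone (facetVertex v π) := by
  intro i j hij c
  have : i.val ≤ j.val := hij
  rw [facetVertex_apply, facetVertex_apply]
  split_ifs <;> first | omega | simp

theorem facetVertex_injective {k : ℕ} (v : Fin (k - 1) → ℤ) (π : Equiv.Perm (Fin (k - 1))) :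
    Function.Injective (facetVertex v π) := by
  have key : ∀ i j : Fin k, i < j → facetVertex v π i ≠ facetVertex v π j := by
    intro i j hij h
    have hij' : i.val < j.val := hij
    have hj := j.isLt
    -- This letter is raised for the first time at vertex `j`.
    have := congrFun h (π ⟨k - 1 - j.val, by omega⟩)
    simp only [facetVertex_apply, Equiv.symm_apply_apply] at this
    rw [if_neg (by omega), if_pos (by omega)] at this
    omega
  intro i j h
  rcases lt_trichotomy i j with hij | hij | hij
  · exact absurd h (key i j hij)
  · exact hij
  · exact absurd h.symm (key j i hij)

theorem card_facet {k : ℕ} (v : Fin (k - 1) → ℤ) (π : Equiv.Perm (Fin (k - 1))) :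
    (facet v π).card = k := by
  rw [facet, Finset.card_image_of_injective _ (facetVertex_injective v π), Finset.card_univ,
    Fintype.card_fin]

theorem isCell_facet {k : ℕ} (v : Fin (k - 1) → ℤ) (π : Equiv.Perm (Fin (k - 1))) :
    IsCell (facet v π : Set (Fin (k - 1) → ℤ)) := by
  intro a ha b hb
  simp only [facet, Finset.coe_image, Finset.coe_univ, Set.image_univ, Set.mem_range] at ha hb
  obtain ⟨i, rfl⟩ := ha
  obtain ⟨j, rfl⟩ := hb
  refine ⟨(le_total i j).imp (fun h => facetVertex_mono v π h) (fun h => facetVertex_mono v π h),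
    fun c => ?_⟩
  simp only [Pi.add_apply, Pi.one_apply, facetVertex_apply]
  split_ifs <;> omega

/-- An upper set is a final segment, here in the form used by `facetVertex`, with `j` its size. -/
theorem exists_forall_mem_iff_of_isUpperSet {n : ℕ} {U : Set (Fin n)} (hU : IsUpperSet U) :
    ∃ j ≤ n, ∀ p, p ∈ U ↔ n ≤ p.val + j := by
  classical
  rcases U.eq_empty_or_nonempty with rfl | hne
  · exact ⟨0, by omega, fun p => by simp⟩
  · obtain ⟨p, hp⟩ := U.toFinite.exists_minimal hne
    refine ⟨n - p, by omega, fun r => ⟨fun hr => ?_, fun hr => hU (a := p) ?_ hp.1⟩⟩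
    · have : p ≤ r := by
        rcases le_total p r with h | h
        · exact h
        · exact hp.2 hr h
      have : p.val ≤ r.val := this
      omega
    · have := p.isLt
      exact Fin.le_def.2 (by omega)

/-- Every cell is contained in a facet. The coordinates are increased in the order of the first
vertex of the cell at which they have been increased, ties being broken by the larger index. -/
theorem exists_facet_of_isCell {k q : ℕ} (hk : 1 ≤ k) (hq : 1 ≤ q) {s : Finset (Fin (k - 1) → ℤ)}
    (hne : s.Nonempty) (hW : (s : Set (Fin (k - 1) → ℤ)) ⊆ vertexSet k q)
    (hs : IsCell (s : Set (Fin (k - 1) → ℤ))) : ∃ F ∈ facets k q, s ⊆ F := by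
  classical
  obtain ⟨m, hm, hmin⟩ := s.exists_minimal hne
  have hle : ∀ u ∈ s, m ≤ u := fun u hu => by
    rcases (hs m hm u hu).1 with h | h
    · exact h
    · exact hmin hu h
  -- The last vertex of a facet raises every coordinate, so the base point must stay at most `q -
  -- 1`.
  set v : Fin (k - 1) → ℤ := fun c => m c - if m c = q then 1 else 0 with hv
  have hmW := hW hm
  have hq' : (1 : ℤ) ≤ q := by exact_mod_cast hq
  have hv0 : ∀ c, 0 ≤ v c := fun c => by
    have := hmW.2 c
    simp only [hv]
    split_ifs <;> omega
  have hvq : ∀ c, v c + 1 ≤ q := fun c => by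
    have := hmW.2 c
    simp only [hv]
    split_ifs <;> omega
  have hvmono : Monotone v := fun c c' h => by
    have h1 := hmW.1 h
    have h2 := hmW.2 c'
    simp only [hv]
    split_ifs <;> omega
  have hu : ∀ u ∈ s, ∀ c, v c ≤ u c ∧ u c ≤ v c + 1 := fun u hu c => by
    have h1 : m c ≤ u c := hle u hu c
    have h2 := (hs u hu m hm).2 c
    have h3 := (hW hu).2 c
    simp only [Pi.add_apply, Pi.one_apply] at h2
    simp only [hv]
    split_ifs <;> omega
  -- A large `r c` means that `c` is raised late in the chain. Since a facet raises the last letters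
  -- of `π` first, `key` sorts by decreasing `r`.
  set r : Fin (k - 1) → ℕ := fun c => (s.filter fun u => u c = v c).card with hr
  set key : Fin (k - 1) → ℕᵒᵈ ×ₗ Fin (k - 1) := fun c => toLex (OrderDual.toDual (r c), c) with hkey
  have hkeyinj : Function.Injective key := fun c c' h => by
    have := congrArg (fun x => (ofLex x).2) h
    simpa [hkey] using this
  have hkeyr : ∀ c c', key c ≤ key c' → r c' ≤ r c := fun c c' h => by
    rcases (Prod.Lex.toLex_le_toLex.1 h) with h | h
    · exact (OrderDual.toDual_lt_toDual.1 h).le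
    · exact (OrderDual.toDual_le_toDual.1 h.1.le)
  have hkeylt : ∀ c c', c < c' → v c = v c' → key c < key c' := fun c c' hcc hvv => by
    -- A vertex `u` is monotone, so if `c'` is not yet raised in `u`, neither is `c`.
    have hrr : r c' ≤ r c := by
      refine Finset.card_le_card fun u hus => ?_
      obtain ⟨hus, h⟩ := Finset.mem_filter.1 hus
      refine Finset.mem_filter.2 ⟨hus, le_antisymm ?_ (hu u hus c).1⟩
      rw [hvv, ← h]
      exact (hW hus).1 hcc.le
    refine Prod.Lex.toLex_lt_toLex.2 ?_
    rcases hrr.lt_or_eq with h | h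
    · exact Or.inl (OrderDual.toDual_lt_toDual.2 h)
    · exact Or.inr ⟨congrArg OrderDual.toDual h.symm, hcc⟩
  set π : Equiv.Perm (Fin (k - 1)) := Tuple.sort key with hπ
  have hπmono : StrictMono (key ∘ π) :=
    (Tuple.monotone_sort key).strictMono_of_injective (hkeyinj.comp π.injective)
  have hπlt : ∀ c c', key c < key c' ↔ π.symm c < π.symm c' := fun c c' => by
    rw [← hπmono.lt_iff_lt]; simp
  have hcons : Consistent v π := fun i j hij hvv =>
    (hπlt i j).1 (hkeylt i j (Fin.lt_def.2 (by omega)) hvv)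
  refine ⟨facet v π, ⟨v, ⟨hvmono, fun c => ⟨hv0 c, by linarith [hvq c]⟩⟩, π, hcons, ?_, rfl⟩, ?_⟩
  · intro x hx
    simp only [facet, Finset.coe_image, Finset.coe_univ, Set.image_univ, Set.mem_range] at hx
    obtain ⟨j, rfl⟩ := hx
    refine ⟨fun c c' hcc => ?_, fun c => ?_⟩
    · rcases hcc.lt_or_eq with hlt | rfl
      · have h1 := hvmono hcc
        rw [facetVertex_apply, facetVertex_apply]
        rcases h1.lt_or_eq with h2 | h2
        · split_ifs <;> omega
        · have h3 : (π.symm c).val < (π.symm c').val := (hπlt c c').1 (hkeylt c c' hlt h2)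
          split_ifs <;> omega
      · exact le_rfl
    · have h0 := hv0 c
      have h1 := hvq c
      rw [facetVertex_apply]
      split_ifs <;> constructor <;> omega
  · intro u hus
    -- If `π p` were raised in `u` and the later `π p'` not, every member with `π p` unraised would
    -- lie below `u` and have `π p'` unraised too. As `u` itself makes this inclusion strict, `r (π
    -- p) < r (π p')`, against the sorting.
    have hup : IsUpperSet {p : Fin (k - 1) | u (π p) = v (π p) + 1} := by
      intro p p' hpp hp
      simp only [Set.mem_ofPred_eq] at hp ⊢
      by_contra hp'
      have hup' : u (π p') = v (π p') := by
        have := hu u hus (π p')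
        omega
      have hr1 : r (π p') ≤ r (π p) := hkeyr _ _ (hπmono.monotone hpp)
      have hr2 : r (π p) < r (π p') := by
        refine Finset.card_lt_card (Finset.ssubset_iff_of_subset ?_ |>.2 ⟨u, ?_, ?_⟩)
        · intro w hw
          obtain ⟨hw, hwp⟩ := Finset.mem_filter.1 hw
          refine Finset.mem_filter.2 ⟨hw, ?_⟩
          rcases (hs w hw u hus).1 with h | h
          · have h1 : w (π p') ≤ u (π p') := h (π p')
            have h2 := (hu w hw (π p')).1
            omega
          · have h1 : u (π p) ≤ w (π p) := h (π p)
            omega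
        · exact Finset.mem_filter.2 ⟨hus, hup'⟩
        · intro h
          have := (Finset.mem_filter.1 h).2
          omega
      omega
    obtain ⟨j, hj, hjU⟩ := exists_forall_mem_iff_of_isUpperSet hup
    refine Finset.mem_image.2 ⟨⟨j, by omega⟩, Finset.mem_univ _, ?_⟩
    funext c
    have h1 := hjU (π.symm c)
    simp only [Set.mem_ofPred_eq, Equiv.apply_symm_apply] at h1
    have h2 := hu u hus c
    rw [facetVertex_apply]
    split_ifs with h
    · exact (h1.2 h).symm
    · have := mt h1.1 h
      omega

theorem mem_faces_iff {k q : ℕ} (hk : 1 ≤ k) (hq : 1 ≤ q) {s : Finset (Fin (k - 1) → ℤ)} :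
    s ∈ (edgewiseSubdivision k q).faces ↔ s.Nonempty ∧ s ∈ cells k q := by
  rw [mem_cells]
  constructor
  · rintro ⟨hne, F, ⟨v, -, π, -, hF, rfl⟩, hsF⟩
    have hsF' : (s : Set (Fin (k - 1) → ℤ)) ⊆ facet v π := Finset.coe_subset.2 hsF
    exact ⟨hne, hsF'.trans hF,
      fun a ha b hb => isCell_facet v π a (hsF' ha) b (hsF' hb)⟩
  · rintro ⟨hne, hW, hs⟩
    exact ⟨hne, exists_facet_of_isCell hk hq hne hW hs⟩

theorem card_le_of_mem_faces {k q : ℕ} {s : Finset (Fin (k - 1) → ℤ)}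
    (hs : s ∈ (edgewiseSubdivision k q).faces) : s.card ≤ k := by
  obtain ⟨-, F, ⟨v, -, π, -, -, rfl⟩, hsF⟩ := hs
  exact (Finset.card_le_card hsF).trans_eq (card_facet v π)

theorem dimAddOne_edgewiseSubdivision {k q : ℕ} (hk : 1 ≤ k) (hq : 1 ≤ q) :
    (edgewiseSubdivision k q).dimAddOne = k := by
  refine IsGreatest.csSup_eq ⟨?_, ?_⟩
  -- A facet exists because the origin alone is a cell.
  · obtain ⟨F, hF, -⟩ := exists_facet_of_isCell (q := q) hk hq
      (Finset.singleton_nonempty (0 : Fin (k - 1) → ℤ))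
      (by
        rw [Finset.coe_singleton, Set.singleton_subset_iff]
        exact ⟨fun _ _ _ => le_rfl, fun _ => ⟨le_rfl, by simp⟩⟩)
      (by
        intro a ha b hb
        rw [Finset.coe_singleton, Set.mem_singleton_iff] at ha hb
        subst ha hb
        exact ⟨Or.inl le_rfl, fun _ => by simp⟩)
    obtain ⟨v, -, π, -, -, rfl⟩ := id hF
    refine ⟨facet v π, ⟨Finset.card_pos.1 ?_, _, hF, subset_rfl⟩, card_facet v π⟩
    rw [card_facet]
    exact hk
  · rintro _ ⟨s, hs, rfl⟩
    exact card_le_of_mem_faces hs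

theorem fVector_edgewiseSubdivision {k q : ℕ} (hk : 1 ≤ k) (hq : 1 ≤ q) (m : ℕ) :
    (edgewiseSubdivision k q).fVector m = ((cells k q).filter fun s => s.card = m).card := by
  unfold PreAbstractSimplicialComplex.fVector
  split_ifs with hm
  · subst hm
    rw [eq_comm, Finset.card_eq_one]
    refine ⟨∅, ?_⟩
    ext s
    simp only [Finset.mem_filter, Finset.card_eq_zero, Finset.mem_singleton, and_iff_right_iff_imp]
    rintro rfl
    exact mem_cells.2 ⟨by simp, fun a ha => absurd ha (by simp)⟩
  · rw [← Set.ncard_coe_finset]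
    congr 1
    ext s
    simp only [Set.mem_ofPred_eq, mem_faces_iff hk hq, Finset.coe_filter]
    refine ⟨fun h => ⟨h.1.2, h.2⟩, fun h => ⟨⟨Finset.card_pos.1 ?_, h.1⟩, h.2⟩⟩
    rw [h.2]
    exact Nat.pos_of_ne_zero hm

end EdgewiseSubdivision

/-! ### The `h`-vector of the edgewise subdivision -/

theorem mainTheorem2 (k q : ℕ) (hk : 1 ≤ k) (hq : 1 ≤ q) (i : ℕ) (hi : i ≤ k) :
    (edgewiseSubdivision k q).hVector i =
      ∑ j ∈ Finset.range (i + 1),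
        (-1 : ℤ) ^ j * (k.choose j : ℤ) * (((i - j) * q + k - 1).choose (k - 1) : ℤ) := by
  have hd : ∀ F ∈ EdgewiseSubdivision.cells k q, F.card ≤ k := by
    intro F hF
    rcases F.eq_empty_or_nonempty with rfl | hne
    · simp
    · exact EdgewiseSubdivision.card_le_of_mem_faces ((EdgewiseSubdivision.mem_faces_iff hk hq).2 ⟨hne, hF⟩)
  have h := sum_neg_one_pow_choose_mul_card_multisets _ hd hi
  simp only [EdgewiseSubdivision.card_multisets_cells, EdgewiseSubdivision.ncard_vertexSet _ _ hk] at h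
  simp only [PreAbstractSimplicialComplex.hVector, EdgewiseSubdivision.dimAddOne_edgewiseSubdivision hk hq,
    EdgewiseSubdivision.fVector_edgewiseSubdivision hk hq]
  exact h.symm
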